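/- Let $k\ge 2$ and $n\ge 0$ be integers and let $\kappa^+,\kappa^-\in\mathbb Z_{\ge 0}^k$ with $\kappa^-\le\kappa^+$ componentwise. Let $BPP(\kappa^+,\kappa^-)\subseteq\mathbb R^{k\times n}$ be the bounded-size partition polytope, i.e. the polytope of all $y=(y_{ij})$ with $$\sum_{i=1}^k y_{ij}=1\ (1\le j\le n),\qquad \sum_{j=1}^n y_{ij}\ge\kappa_i^-,\quad \sum_{j=1}^n y_{ij}\le\kappa_i^+\ (1\le i\le k),\qquad y_{ij}\ge 0\ (1\le i\le k,\ 1\le j\le n).$$ For a polyhedron $P=\{x\in\mathbb R^m : Ax=b,\ Bx\le d\}$, a circuit is a vector $g\in\ker(A)\setminus\{0\}$ with coprime integer components such that $Bg$ is support-minimal in $\{Bx : x\in\ker(A)\setminus\{0\}\}$. A circuit walk of length $\ell$ from $y$ to $y'$ is a sequence $y=y_0,y_1,\dots,y_\ell=y'$ of points of $P$ such that for each $t<\ell$ there are a circuit $g_t$ and $\alpha_t>0$ with $y_{t+1}=y_t+\alpha_t g_t$ and $y_t+\alpha g_t\notin P$ for all $\alpha>\alpha_t$. The circuit distance from $y$ to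 $y'$ is the minimum length of such a walk, and the circuit diameter of $P$ is the maximum circuit distance over all ordered pairs of vertices of $P$ (and $0$ if $P$ has no vertices). Circuits of $BPP(\kappa^+,\kappa^-)$ are taken with respect to the above system of constraints. Assume that $\kappa_1^+\ge\cdots\ge\kappa_k^+$, and let $i_1\ne i_2$ be two indices with the smallest values of $\kappa_i^+-\kappa_i^-$, i.e. $\kappa_{i_1}^+-\kappa_{i_1}^-\le\kappa_i^+-\kappa_i^-$ and $\kappa_{i_2}^+-\kappa_{i_2}^-\le\kappa_i^+-\kappa_i^-$ for all $i\notin\{i_1,i_2\}$. Then the circuit diameter of $BPP(\kappa^+,\kappa^-)$ is finite and at most $$\kappa_1^+ + \kappa_2^+ + \frac12\sum_{i\ne i_1,i_2}(\kappa_i^+-\kappa_i^-).$$ -/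

import Mathlib

/-- A system of linear constraints `A x = b`, `B x ≤ d` in the real variables `x v`, `v : V`, with
equations indexed by `E` and inequalities indexed by `I`. -/
structure LinSystem (V E I : Type*) where
  A : Matrix E V ℝ
  b : E → ℝ
  B : Matrix I V ℝ
  d : I → ℝ

namespace LinSystem

variable {V E I : Type*} [Fintype V]

/-- The polyhedron `P = {x | A x = b, B x ≤ d}`. -/
def polyhedron (S : LinSystem V E I) : Set (V → ℝ) :=
  {x | S.A.mulVec x = S.b ∧ S.B.mulVec x ≤ S.d}

/-- `g` is a circuit of `P`: a nonzero vector of `ker A` with coprime integer components such that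
`B g` is support-minimal over `{B x | x ∈ ker A \ {0}}`. -/
structure IsCircuit (S : LinSystem V E I) (g : V → ℝ) : Prop where
  mem_ker : S.A.mulVec g = 0
  ne_zero : g ≠ 0
  coprime : ∃ z : V → ℤ, (∀ v, g v = (z v : ℝ)) ∧ Finset.univ.gcd z = 1
  minimal : ∀ x : V → ℝ, S.A.mulVec x = 0 → x ≠ 0 →
    Function.support (S.B.mulVec x) ⊆ Function.support (S.B.mulVec g) →
    Function.support (S.B.mulVec x) = Function.support (S.B.mulVec g)

/-- `y'` is reached from `y` by a step of maximal feasible (positive) length along a circuit. -/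
def IsCircuitStep (S : LinSystem V E I) (y y' : V → ℝ) : Prop :=
  ∃ g : V → ℝ, S.IsCircuit g ∧ ∃ α : ℝ, 0 < α ∧ y' = y + α • g ∧
    ∀ β : ℝ, α < β → y + β • g ∉ S.polyhedron

/-- `w 0, …, w ℓ` is a circuit walk in `P` with `ℓ` steps from `y` to `y'`. -/
structure IsCircuitWalk (S : LinSystem V E I) (ℓ : ℕ) (w : Fin (ℓ + 1) → V → ℝ)
    (y y' : V → ℝ) : Prop where
  start : w 0 = y
  finish : w (Fin.last ℓ) = y'
  mem : ∀ i, w i ∈ S.polyhedron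
  step : ∀ i : Fin ℓ, S.IsCircuitStep (w i.castSucc) (w i.succ)

/-- The least number of steps of a circuit walk from `y` to `y'` (`⊤` if there is none). -/
noncomputable def circuitDist (S : LinSystem V E I) (y y' : V → ℝ) : ℕ∞ :=
  ⨅ (ℓ : ℕ) (_ : ∃ w : Fin (ℓ + 1) → V → ℝ, S.IsCircuitWalk ℓ w y y'), (ℓ : ℕ∞)

/-- The circuit diameter: the supremum of the circuit distances over all pairs of vertices
(extreme points) of `P`. -/
noncomputable def circuitDiameter (S : LinSystem V E I) : ℕ∞ :=
  ⨆ (y ∈ Set.extremePoints ℝ S.polyhedron) (y' ∈ Set.extremePoints ℝ S.polyhedron),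
    S.circuitDist y y'

end LinSystem

/-- The constraint system of the bounded-size partition polytope `BPP(κ⁺, κ⁻)` for `n` items and
`k` clusters, in the variables `y (i, j)` (cluster `i`, item `j`). The inequalities are
`-∑ j, y (i, j) ≤ -κ⁻ i`, `∑ j, y (i, j) ≤ κ⁺ i` and `-y (i, j) ≤ 0`. -/
def BPP {k : ℕ} (n : ℕ) (κp κm : Fin k → ℕ) :
    LinSystem (Fin k × Fin n) (Fin n) (Fin k ⊕ Fin k ⊕ Fin k × Fin n) where
  A := Matrix.of fun j v => if v.2 = j then 1 else 0
  b := fun _ => 1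
  B := Matrix.of fun c v => match c with
    | Sum.inl i => if v.1 = i then -1 else 0
    | Sum.inr (Sum.inl i) => if v.1 = i then 1 else 0
    | Sum.inr (Sum.inr u) => if v = u then -1 else 0
  d := fun c => match c with
    | Sum.inl i => -(κm i : ℝ)
    | Sum.inr (Sum.inl i) => (κp i : ℝ)
    | Sum.inr (Sum.inr _) => 0

/-- The polyhedron of the system `BPP` written out. -/
theorem mem_BPP_polyhedron {k n : ℕ} (κp κm : Fin k → ℕ) (y : Fin k × Fin n → ℝ) :
    y ∈ (BPP n κp κm).polyhedron ↔
      (∀ j, ∑ i, y (i, j) = 1) ∧ (∀ i, (κm i : ℝ) ≤ ∑ j, y (i, j)) ∧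
      (∀ i, ∑ j, y (i, j) ≤ (κp i : ℝ)) ∧ ∀ i j, 0 ≤ y (i, j) := by
  have hA : ∀ j, (BPP n κp κm).A.mulVec y j = ∑ i, y (i, j) := fun j => by
    simp [BPP, Matrix.mulVec, dotProduct, Fintype.sum_prod_type]
  have h1 : ∀ i, (BPP n κp κm).B.mulVec y (Sum.inl i) = -∑ j, y (i, j) := fun i => by
    simp only [BPP, Matrix.mulVec, dotProduct, Matrix.of_apply, Fintype.sum_prod_type_right]
    simp
  have h2 : ∀ i, (BPP n κp κm).B.mulVec y (Sum.inr (Sum.inl i)) = ∑ j, y (i, j) := fun i => by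
    simp only [BPP, Matrix.mulVec, dotProduct, Matrix.of_apply, Fintype.sum_prod_type_right]
    simp
  have h3 : ∀ u, (BPP n κp κm).B.mulVec y (Sum.inr (Sum.inr u)) = -y u := fun u => by
    simp [BPP, Matrix.mulVec, dotProduct]
  simp only [LinSystem.polyhedron, Set.mem_ofPred_eq, funext_iff, Pi.le_def, Sum.forall, hA, h1, h2,
    h3, Prod.forall]
  simp [BPP]

/-! Vertices are incidence vectors of clusterings. For clusterings `C`, `T` the difference graph has
an arc from `C j` to `T j` for each item `j`. Moving one item along each arc of a cycle, or of a
cycle with one arc left out (a path), is a circuit step of maximal length 1.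

Equalising sizes: a path from a cluster that is too large to one that is too small lowers the excess
`e = ½ ∑ |C.size i - T.size i|` by one, and all sizes stay between those of `C` and `T`
(`exists_step_excess`).

Equal sizes: let `r i` be the number of misplaced items of cluster `i`, with `r u ≥ r v` the two
largest. By Birkhoff's theorem, disjoint cycles of the difference graph cover all clusters of
maximal `r` (`exists_perm_cover`). While `u` alone is maximal, its cycle suffices: `r u - r v`
steps. Afterwards each family of disjoint cycles costs two steps, since a permutation is a product
of two cycles within its support (`exists_cyclicAt_mul_cyclicAt`): `2 * r v` steps.

The total is at most `r u + r v + e`. As `r i ≤ min (C.size i) (T.size i)`, the sum `r i + |C.size i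
- T.size i|` is at most `κp i`. This is used for `u` and `v`; every other size difference is at most
`κp i - κm i`. -/

theorem BPP_A_mulVec {k n : ℕ} (κp κm : Fin k → ℕ) (y : Fin k × Fin n → ℝ) (j : Fin n) :
    (BPP n κp κm).A.mulVec y j = ∑ i, y (i, j) := by
  simp [BPP, Matrix.mulVec, dotProduct, Fintype.sum_prod_type]

theorem BPP_B_mulVec_inl {k n : ℕ} (κp κm : Fin k → ℕ) (y : Fin k × Fin n → ℝ) (i : Fin k) :
    (BPP n κp κm).B.mulVec y (Sum.inl i) = -∑ j, y (i, j) := by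
  simp only [BPP, Matrix.mulVec, dotProduct, Matrix.of_apply, Fintype.sum_prod_type_right]
  simp

theorem BPP_B_mulVec_inr_inr {k n : ℕ} (κp κm : Fin k → ℕ) (y : Fin k × Fin n → ℝ)
    (u : Fin k × Fin n) :
    (BPP n κp κm).B.mulVec y (Sum.inr (Sum.inr u)) = -y u := by
  simp [BPP, Matrix.mulVec, dotProduct]

/-! ### Circuit distances -/

namespace LinSystem

variable {V E I : Type*} [Fintype V]

theorem circuitDist_self (S : LinSystem V E I) {y : V → ℝ} (hy : y ∈ S.polyhedron) :
    S.circuitDist y y = 0 := by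
  refine le_antisymm (iInf₂_le_of_le 0 ⟨fun _ => y, rfl, rfl, fun _ => hy, fun i => i.elim0⟩ ?_)
    zero_le
  simp

theorem circuitDist_le_succ (S : LinSystem V E I) {y y' z : V → ℝ} {m : ℕ}
    (hy : y ∈ S.polyhedron) (hstep : S.IsCircuitStep y y') (h : S.circuitDist y' z ≤ m) :
    S.circuitDist y z ≤ (m + 1 : ℕ) := by
  -- Strictness turns the bound on an infimum into an actual walk of length at most `m`.
  have hlt : S.circuitDist y' z < (m + 1 : ℕ) := h.trans_lt (by exact_mod_cast Nat.lt_succ_self m)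
  simp only [circuitDist, iInf_lt_iff] at hlt
  obtain ⟨ℓ, ⟨w, hw⟩, hℓ⟩ := hlt
  have hℓ' : ℓ + 1 ≤ m + 1 := by exact_mod_cast hℓ
  refine iInf₂_le_of_le (ℓ + 1) ⟨Fin.cons y w, rfl, ?_, ?_, ?_⟩ (by exact_mod_cast hℓ')
  · rw [← Fin.succ_last, Fin.cons_succ, hw.finish]
  · intro i
    cases i using Fin.cases with
    | zero => exact hy
    | succ i => exact hw.mem i
  · intro i
    cases i using Fin.cases with
    | zero => simpa [hw.start] using hstep
    | succ i => simpa [← Fin.succ_castSucc] using hw.step i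

end LinSystem

/-! ### Clusterings, and exchanges as circuits -/

/-- An assignment of `n` items to `k` clusters. -/
abbrev Clustering (k n : ℕ) := Fin n → Fin k

namespace Clustering

variable {k n : ℕ}

/-- The incidence vector of a clustering. -/
def toPoint (C : Clustering k n) : Fin k × Fin n → ℝ := fun v => if C v.2 = v.1 then 1 else 0

/-- The number of items in cluster `i`. -/
def size (C : Clustering k n) (i : Fin k) : ℕ := (Finset.univ.filter fun j => C j = i).card

/-- All cluster sizes respect the bounds. -/
def Feasible (κp κm : Fin k → ℕ) (C : Clustering k n) : Prop :=
  ∀ i, κm i ≤ C.size i ∧ C.size i ≤ κp i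

theorem sum_toPoint_item (C : Clustering k n) (j : Fin n) : ∑ i, C.toPoint (i, j) = 1 := by
  simp [toPoint]

theorem sum_toPoint_cluster (C : Clustering k n) (i : Fin k) :
    ∑ j, C.toPoint (i, j) = C.size i := by
  simp [toPoint, size]

theorem toPoint_mem_iff {κp κm : Fin k → ℕ} {C : Clustering k n} :
    C.toPoint ∈ (BPP n κp κm).polyhedron ↔ C.Feasible κp κm := by
  rw [mem_BPP_polyhedron]
  simp only [sum_toPoint_item, sum_toPoint_cluster, Nat.cast_le, implies_true, true_and, Feasible,
    forall_and]
  refine and_congr_right fun _ => and_iff_left fun i j => ?_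
  unfold toPoint
  split_ifs <;> norm_num

/-- Move every item of `J` along the permutation `σ` of the clusters. -/
def move (C : Clustering k n) (J : Finset (Fin n)) (σ : Equiv.Perm (Fin k)) : Clustering k n :=
  fun j => if j ∈ J then σ (C j) else C j

theorem move_of_mem {C : Clustering k n} {J : Finset (Fin n)} {σ : Equiv.Perm (Fin k)} {j : Fin n}
    (hj : j ∈ J) : C.move J σ j = σ (C j) := if_pos hj

theorem move_of_notMem {C : Clustering k n} {J : Finset (Fin n)} {σ : Equiv.Perm (Fin k)}
    {j : Fin n} (hj : j ∉ J) : C.move J σ j = C j := if_neg hj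

/-- With at most one item of `J` per cluster, each cluster gives away at most one item and receives
at most one. The additive form avoids truncated subtraction. -/
theorem size_move (C : Clustering k n) {J : Finset (Fin n)} (hJ : Set.InjOn C J)
    (σ : Equiv.Perm (Fin k)) (i : Fin k) :
    (C.move J σ).size i + (if i ∈ J.image C then 1 else 0) =
      C.size i + (if σ⁻¹ i ∈ J.image C then 1 else 0) := by
  have key : ∀ i', (J.filter fun j => C j = i').card = if i' ∈ J.image C then 1 else 0 := by
    intro i'
    split_ifs with h
    · obtain ⟨j, hj, rfl⟩ := Finset.mem_image.1 h
      rw [Finset.card_eq_one]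
      refine ⟨j, Finset.ext fun j' => ?_⟩
      simp only [Finset.mem_filter, Finset.mem_singleton]
      constructor
      · exact fun h => hJ h.1 hj h.2
      · rintro rfl
        exact ⟨hj, rfl⟩
    · rw [Finset.card_eq_zero, Finset.filter_eq_empty_iff]
      exact fun j hj hji => h (Finset.mem_image.2 ⟨j, hj, hji⟩)
  have split : ∀ D : Clustering k n, D.size i =
      (J.filter fun j => D j = i).card + (Jᶜ.filter fun j => D j = i).card := by
    intro D
    rw [size, ← Finset.card_union_of_disjoint, ← Finset.filter_union, Finset.union_compl]
    exact Finset.disjoint_filter_filter disjoint_compl_right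
  have h1 : (J.filter fun j => C.move J σ j = i) = J.filter fun j => C j = σ⁻¹ i :=
    Finset.filter_congr fun j hj => by rw [move_of_mem hj, Equiv.Perm.eq_inv_iff_eq]
  have h2 : (Jᶜ.filter fun j => C.move J σ j = i) = Jᶜ.filter fun j => C j = i :=
    Finset.filter_congr fun j hj => by rw [move_of_notMem (Finset.mem_compl.1 hj)]
  rw [split, split C, h1, h2, key, key]
  ring

/-- Moving one item along each arc of a cycle of clusters, or along each arc but one, is a
circuit. -/
theorem isCircuit_move (κp κm : Fin k → ℕ) (C : Clustering k n) {J : Finset (Fin n)}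
    {τ : Equiv.Perm (Fin k)} {l : Fin k} (hτ : τ.IsCycle) (hJ : Set.InjOn C J)
    (hJτ : ∀ j ∈ J, τ (C j) ≠ C j) (hl : τ l ≠ l)
    (hcov : ∀ i, τ i ≠ i → i ≠ l → ∃ j ∈ J, C j = i) :
    (BPP n κp κm).IsCircuit ((C.move J τ).toPoint - C.toPoint) := by
  set g := (C.move J τ).toPoint - C.toPoint with hg
  have hgv : ∀ i j, g (i, j) = if j ∈ J then
      (if i = τ (C j) then 1 else 0) - (if i = C j then 1 else 0) else 0 := by
    intro i j
    by_cases hj : j ∈ J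
    · simp [hg, toPoint, move_of_mem hj, hj, eq_comm]
    · simp [hg, toPoint, move_of_notMem hj, hj]
  -- Only `l` may lack an item, so the chain of arcs starts at its successor `τ l`.
  obtain ⟨j₀, hj₀, hCj₀⟩ := hcov (τ l) (fun h => hl (τ.injective h)) hl
  have hg₀ : g (τ (C j₀), j₀) = 1 := by simp [hgv, hj₀, hJτ j₀ hj₀]
  have hker : ∀ j, ∑ i, g (i, j) = 0 := by
    intro j
    simp [hg, Finset.sum_sub_distrib, sum_toPoint_item]
  have hne : g ≠ 0 := fun h => by simp [h] at hg₀
  -- every kernel vector whose image is supported in that of `g` is a multiple of `g`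
  have hmul : ∀ x : Fin k × Fin n → ℝ, (BPP n κp κm).A.mulVec x = 0 →
      Function.support ((BPP n κp κm).B.mulVec x) ⊆
        Function.support ((BPP n κp κm).B.mulVec g) → ∃ a : ℝ, x = a • g := by
    intro x hx hs
    have hcol : ∀ j, ∑ i, x (i, j) = 0 := fun j => by
      rw [← BPP_A_mulVec κp κm, hx]; rfl
    have hzero : ∀ i j, g (i, j) = 0 → x (i, j) = 0 := by
      intro i j h
      by_contra hne
      have := @hs (Sum.inr (Sum.inr (i, j)))
      rw [Function.mem_support, Function.mem_support, BPP_B_mulVec_inr_inr,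
        BPP_B_mulVec_inr_inr] at this
      exact this (neg_ne_zero.2 hne) (by rw [h, neg_zero])
    have hrow : ∀ i, ∑ j, g (i, j) = 0 → ∑ j, x (i, j) = 0 := by
      intro i h
      by_contra hne
      have := @hs (Sum.inl i)
      rw [Function.mem_support, Function.mem_support, BPP_B_mulVec_inl, BPP_B_mulVec_inl] at this
      exact this (neg_ne_zero.2 hne) (by rw [h, neg_zero])
    -- Only two entries of the column survive the support condition, and the column sum is zero.
    have hxC : ∀ j ∈ J, x (C j, j) = -x (τ (C j), j) := by
      intro j hj
      have h := hcol j
      rw [Fintype.sum_eq_add (C j) (τ (C j)) (hJτ j hj).symm] at h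
      · linarith
      · rintro i ⟨h1, h2⟩
        exact hzero i j (by simp [hgv, h1, h2])
    have hrow2 : ∀ z : Fin k × Fin n → ℝ, (∀ i j, g (i, j) = 0 → z (i, j) = 0) →
        ∀ j ∈ J, ∀ j' ∈ J, C j' = τ (C j) →
          ∑ p, z (C j', p) = z (C j', j) + z (C j', j') := by
      intro z hz j hj j' hj' h
      have hjj : j ≠ j' := by
        rintro rfl
        exact hJτ j hj h.symm
      refine Fintype.sum_eq_add j j' hjj ?_
      rintro p ⟨h1, h2⟩
      refine hz _ _ ?_
      rw [hgv]
      by_cases hp : p ∈ J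
      · have e1 : ¬ C j' = τ (C p) := fun e => h1 (hJ hp hj (τ.injective (e.symm.trans h)))
        have e2 : ¬ C j' = C p := fun e => h2 (hJ hp hj' e.symm)
        simp [e1, e2]
      · simp [hp]
    -- In a row between consecutive arcs, `g` has the entries `1` and `-1`, hence row sum zero. The
    -- support condition forces the row sum of `x` to vanish too, which carries the coefficient to
    -- the next arc.
    have hstep : ∀ j ∈ J, ∀ j' ∈ J, C j' = τ (C j) → x (τ (C j'), j') = x (τ (C j), j) := by
      intro j hj j' hj' h
      have hg2 := hrow2 g (fun _ _ h => h) j hj j' hj' h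
      have e1 : g (C j', j) = 1 := by simp [hgv, hj, h, hJτ j hj]
      have e2 : g (C j', j') = -1 := by simp [hgv, hj', (hJτ j' hj').symm]
      rw [e1, e2, add_neg_cancel] at hg2
      have hx2 := hrow2 x hzero j hj j' hj' h
      rw [hrow _ hg2, hxC j' hj', h] at hx2
      rw [← h] at hx2 ⊢
      linarith
    have hconst : ∀ (m : ℕ), ∀ j ∈ J, C j = (τ ^ m) (τ l) →
        x (τ (C j), j) = x (τ (C j₀), j₀) := by
      intro m
      induction m with
      | zero =>
        intro j hj h
        rw [hJ hj hj₀ (h.trans hCj₀.symm)]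
      | succ m ih =>
        intro j hj h
        rw [pow_succ', Equiv.Perm.mul_apply] at h
        -- Passing through `l` means that the cycle closes and the arc is again that of `j₀`.
        by_cases hz : (τ ^ m) (τ l) = l
        · rw [hz] at h
          rw [hJ hj hj₀ (h.trans hCj₀.symm)]
        · have hz' : τ ((τ ^ m) (τ l)) ≠ (τ ^ m) (τ l) := by
            intro e
            refine hl ?_
            have hc : τ ((τ ^ m) (τ l)) = (τ ^ m) (τ (τ l)) :=
              Equiv.congr_fun ((pow_succ' τ m).symm.trans (pow_succ τ m)) (τ l)
            rw [hc] at e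
            exact τ.injective ((τ ^ m).injective e)
          obtain ⟨j₁, hj₁, hCj₁⟩ := hcov _ hz' hz
          rw [hstep j₁ hj₁ j hj (by rw [h, hCj₁]), ih j₁ hj₁ hCj₁]
    have hall : ∀ j ∈ J, x (τ (C j), j) = x (τ (C j₀), j₀) := by
      intro j hj
      obtain ⟨m, hm⟩ := hτ.exists_pow_eq (x := τ l) (fun h => hl (τ.injective h)) (hJτ j hj)
      exact hconst m j hj hm.symm
    refine ⟨x (τ (C j₀), j₀), funext fun ⟨i, j⟩ => ?_⟩
    rw [Pi.smul_apply, smul_eq_mul]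
    by_cases hj : j ∈ J
    · by_cases h1 : i = τ (C j)
      · subst h1
        simp [hgv, hj, hJτ j hj, hall j hj]
      · by_cases h2 : i = C j
        · subst h2
          rw [hxC j hj, hall j hj]
          simp [hgv, hj, (hJτ j hj).symm]
        · rw [hzero i j (by simp [hgv, h1, h2])]
          simp [hgv, h1, h2]
    · rw [hzero i j (by simp [hgv, hj])]
      simp [hgv, hj]
  refine ⟨funext fun j => by rw [BPP_A_mulVec, hker]; rfl, hne, ?_, ?_⟩
  · refine ⟨fun v => if v.2 ∈ J then
      (if v.1 = τ (C v.2) then 1 else 0) - (if v.1 = C v.2 then 1 else 0) else 0, ?_, ?_⟩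
    · rintro ⟨i, j⟩
      rw [hgv]
      push_cast
      rfl
    · refine Int.eq_one_of_dvd_one ?_ ?_
      · rw [← Finset.normalize_gcd]
        exact Int.nonneg_of_normalize_eq_self (normalize_idem _)
      · refine (Finset.gcd_dvd (Finset.mem_univ (τ (C j₀), j₀))).trans ?_
        simp [hj₀, hJτ j₀ hj₀]
  · intro x hx hx0 hs
    obtain ⟨a, rfl⟩ := hmul x hx hs
    have ha : a ≠ 0 := by
      rintro rfl
      exact hx0 (zero_smul _ _)
    rw [Matrix.mulVec_smul]
    exact Function.support_const_smul_of_ne_zero _ _ ha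

/-- The exchange step along a circuit of the preceding kind. -/
theorem isCircuitStep_move (κp κm : Fin k → ℕ) (C : Clustering k n) {J : Finset (Fin n)}
    {τ : Equiv.Perm (Fin k)} {l : Fin k} (hτ : τ.IsCycle) (hJ : Set.InjOn C J)
    (hJτ : ∀ j ∈ J, τ (C j) ≠ C j) (hl : τ l ≠ l)
    (hcov : ∀ i, τ i ≠ i → i ≠ l → ∃ j ∈ J, C j = i) :
    (BPP n κp κm).IsCircuitStep C.toPoint (C.move J τ).toPoint := by
  refine ⟨_, isCircuit_move κp κm C hτ hJ hJτ hl hcov, 1, one_pos, by simp, fun β hβ hmem => ?_⟩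
  obtain ⟨j₀, hj₀, -⟩ := hcov (τ l) (fun h => hl (τ.injective h)) hl
  -- Beyond length 1 the entry at `(C j₀, j₀)`, equal to `1 - β`, is negative.
  have h := ((mem_BPP_polyhedron _ _ _).1 hmem).2.2.2 (C j₀) j₀
  simp [toPoint, move_of_mem hj₀, hJτ j₀ hj₀] at h
  linarith

end Clustering

/-! ### Permutations as products of two cycles -/

namespace Equiv.Perm

variable {α : Type*}

/-- `f` has at most one nontrivial cycle, and this cycle contains `x` if it exists. -/
def CyclicAt (f : Perm α) (x : α) : Prop := ∀ w, f w ≠ w → f.SameCycle x w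

theorem CyclicAt.isCycle_or_eq_one {f : Perm α} {x : α} (h : f.CyclicAt x) :
    f.IsCycle ∨ f = 1 := by
  by_cases hx : f x = x
  · refine Or.inr (Equiv.ext fun w => ?_)
    by_contra hw
    exact hw (((h w hw).apply_eq_self_iff).1 hx)
  · exact Or.inl ⟨x, hx, fun w hw => h w hw⟩

theorem cyclicAt_one (x : α) : (1 : Perm α).CyclicAt x := fun _ h => absurd rfl h

theorem IsCycle.cyclicAt {f : Perm α} (h : f.IsCycle) {x : α} (hx : f x ≠ x) : f.CyclicAt x :=
  fun _ hw => h.sameCycle hx hw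

theorem CyclicAt.apply {f : Perm α} {x : α} (h : f.CyclicAt x) : f.CyclicAt (f x) :=
  fun w hw => sameCycle_apply_left.2 (h w hw)

variable [Finite α] [DecidableEq α]

/-- Multiplication by a transposition merges two disjoint cycles. -/
theorem CyclicAt.swap_mul {f g : Perm α} {x y : α} (hf : f.CyclicAt x) (hg : g.CyclicAt y)
    (hfg : f.Disjoint g) (hgx : g x = x) (hfy : f y = y) :
    (swap x y * (f * g)).CyclicAt x := by
  set h := swap x y * (f * g) with hh
  have hcomm : ∀ w, f (g w) = g (f w) := fun w => Equiv.congr_fun hfg.commute.eq w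
  -- Along the `f`-cycle of `x`, the map `h` agrees with `f` until `f` would return to `x`.
  have hF : ∀ m : ℕ, h.SameCycle x ((f ^ m) x) := by
    intro m
    induction m with
    | zero => exact SameCycle.refl _ _
    | succ m ih =>
      rw [pow_succ', mul_apply]
      by_cases hx : f ((f ^ m) x) = x
      · rw [hx]
      · have hgm : g ((f ^ m) x) = (f ^ m) x := by
          have := Equiv.congr_fun ((hfg.commute.pow_left m).eq) x
          rw [mul_apply, mul_apply, hgx] at this
          exact this.symm
        have hy : f ((f ^ m) x) ≠ y := by
          intro e
          rw [← hfy] at e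
          have e' := f.injective e
          have e2 : (f ^ m) x = (f ^ m) y := by rw [e', pow_apply_eq_self_of_apply_eq_self hfy]
          have e3 := (f ^ m).injective e2
          rw [e3] at hx
          exact hx (by rw [pow_apply_eq_self_of_apply_eq_self hfy, hfy])
        have : h ((f ^ m) x) = f ((f ^ m) x) := by
          rw [hh, mul_apply, mul_apply, hgm, swap_apply_of_ne_of_ne hx hy]
        rw [← this]
        exact sameCycle_apply_right.2 ih
  have hG : ∀ m : ℕ, h.SameCycle y ((g ^ m) y) := by
    intro m
    induction m with
    | zero => exact SameCycle.refl _ _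
    | succ m ih =>
      rw [pow_succ', mul_apply]
      by_cases hy : g ((g ^ m) y) = y
      · rw [hy]
      · have hfm : f ((g ^ m) y) = (g ^ m) y := by
          have := Equiv.congr_fun ((hfg.commute.pow_right m).eq) y
          rw [mul_apply, mul_apply, hfy] at this
          exact this
        have hx : g ((g ^ m) y) ≠ x := by
          intro e
          rw [← hgx] at e
          have e' := g.injective e
          have e2 : (g ^ m) y = (g ^ m) x := by rw [e', pow_apply_eq_self_of_apply_eq_self hgx]
          have e3 := (g ^ m).injective e2
          rw [e3] at hy
          exact hy (by rw [pow_apply_eq_self_of_apply_eq_self hgx, hgx])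
        have : h ((g ^ m) y) = g ((g ^ m) y) := by
          rw [hh, mul_apply, mul_apply, hcomm, hfm, swap_apply_of_ne_of_ne hx hy]
        rw [← this]
        exact sameCycle_apply_right.2 ih
  -- The cycles are joined at `f⁻¹ x`, which `h` sends to `y` instead of `x`.
  have hxy : h.SameCycle x y := by
    obtain ⟨m, hm⟩ : ∃ m : ℕ, (f ^ m) x = f⁻¹ x := by
      obtain ⟨m, -, hm⟩ := (sameCycle_symm_apply_right.2 (SameCycle.refl f x)).exists_pow_eq'
      exact ⟨m, hm⟩
    have h1 := hF m
    have hgm : g (f⁻¹ x) = f⁻¹ x := by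
      have := Equiv.congr_fun (hfg.commute.inv_left.eq) x
      rw [mul_apply, mul_apply, hgx] at this
      exact this.symm
    rw [hm] at h1
    have h2 : h (f⁻¹ x) = y := by
      rw [hh, mul_apply, mul_apply, hgm, inv_def, apply_symm_apply, swap_apply_left]
    rw [← h2]
    exact sameCycle_apply_right.2 h1
  intro w hw
  by_cases hfw : f w = w
  · by_cases hgw : g w = w
    · by_cases hwx : w = x
      · rw [hwx]
      · by_cases hwy : w = y
        · rw [hwy]; exact hxy
        · exact absurd (by rw [hh, mul_apply, mul_apply, hgw, hfw,
            swap_apply_of_ne_of_ne hwx hwy]) hw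
    · obtain ⟨m, -, hm⟩ := (hg w hgw).exists_pow_eq'
      rw [← hm]
      exact hxy.trans (hG m)
  · obtain ⟨m, -, hm⟩ := (hf w hfw).exists_pow_eq'
    rw [← hm]
    exact hF m

/-- Every permutation is the product of two permutations that are cycles or trivial and move
only points moved by the given one. -/
theorem exists_cyclicAt_mul_cyclicAt (σ : Perm α) (hσ : σ ≠ 1) :
    ∃ (τ₁ τ₂ : Perm α) (x : α), σ = τ₂ * τ₁ ∧ τ₁.CyclicAt x ∧ τ₂.CyclicAt x ∧ σ x ≠ x ∧
      (∀ w, σ w = w → τ₁ w = w) ∧ ∀ w, σ w = w → τ₂ w = w := by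
  induction σ using cycle_induction_on with
  | base_one => exact absurd rfl hσ
  | base_cycles σ h =>
    obtain ⟨x, hx, -⟩ := id h
    exact ⟨σ, 1, x, (one_mul σ).symm, h.cyclicAt hx, cyclicAt_one x, hx, fun _ h => h,
      fun _ _ => rfl⟩
  | induction_disjoint c σ hd hc _ ih =>
    obtain ⟨x, hx, -⟩ := id hc
    by_cases h1 : σ = 1
    · subst h1
      exact ⟨c, 1, x, by simp, hc.cyclicAt hx, cyclicAt_one x, by simpa using hx,
        fun w h => by simpa using h, fun _ _ => rfl⟩
    obtain ⟨τ₁, τ₂, y, rfl, h₁, h₂, hy, hs₁, hs₂⟩ := ih h1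
    have hd₁ : c.Disjoint τ₁ := fun w => (hd w).imp_right (hs₁ w)
    have hd₂ : c.Disjoint τ₂ := fun w => (hd w).imp_right (hs₂ w)
    have hfix : ∀ w, (c * (τ₂ * τ₁)) w = w → c w = w ∧ (τ₂ * τ₁) w = w := fun w hw =>
      (hd.mul_apply_eq_iff).1 hw
    have hσx : (τ₂ * τ₁) x = x := (hd x).resolve_left hx
    have hcy : c y = y := (hd y).resolve_right hy
    have hcy2 : c (τ₂ y) = τ₂ y := by
      have := Equiv.congr_fun hd₂.commute.eq y
      rwa [mul_apply, mul_apply, hcy] at this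
    -- The new cycle `c` is merged into `τ₁` by a transposition. The second factor undoes it:
    -- conjugated past `τ₂` it becomes `swap x (τ₂ y)`, which merely inserts the point `x` into the
    -- cycle of `τ₂`.
    refine ⟨swap x y * (c * τ₁), swap x (τ₂ y) * (1 * τ₂), x, ?_, ?_, ?_, ?_, ?_, ?_⟩
    · have h3 : τ₂ * swap x y = swap x (τ₂ y) * τ₂ := by
        rw [mul_swap_eq_swap_mul, hs₂ x hσx]
      rw [one_mul, ← h3]
      calc c * (τ₂ * τ₁) = τ₂ * (c * τ₁) := by
            rw [← mul_assoc, hd₂.commute.eq, mul_assoc]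
        _ = τ₂ * (swap x y * swap x y) * (c * τ₁) := by rw [swap_mul_self, mul_one]
        _ = _ := by simp only [mul_assoc]
    · exact (hc.cyclicAt hx).swap_mul h₁ hd₁ (hs₁ x hσx) hcy
    · exact (cyclicAt_one x).swap_mul h₂.apply (disjoint_one_left _) (hs₂ x hσx) rfl
    · exact fun h => hx (hfix x h).1
    · intro w hw
      obtain ⟨hw1, hw2⟩ := hfix w hw
      have e1 : w ≠ x := by rintro rfl; exact hx hw1
      have e2 : w ≠ y := by rintro rfl; exact hy hw2
      rw [mul_apply, mul_apply, hs₁ w hw2, hw1, swap_apply_of_ne_of_ne e1 e2]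
    · intro w hw
      obtain ⟨hw1, hw2⟩ := hfix w hw
      have e1 : w ≠ x := by rintro rfl; exact hx hw1
      have e2 : w ≠ τ₂ y := by
        intro e
        have : y = w := by
          refine τ₂.injective ?_
          rw [hs₂ w hw2, e]
        exact hy (this ▸ hw2)
      rw [mul_apply, one_mul, hs₂ w hw2, swap_apply_of_ne_of_ne e1 e2]

end Equiv.Perm

/-! ### Closing paths to cycles -/

/-- If `t` can be reached from `s` in a directed graph, then some permutation maps `t` to `s` and
every other point it moves along an arc. -/
theorem exists_perm_of_reflTransGen {α : Type*} [DecidableEq α] (r : α → α → Prop) {s t : α}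
    (h : Relation.ReflTransGen r s t) :
    ∃ σ : Equiv.Perm α, σ t = s ∧ ∀ w, w ≠ t → σ w ≠ w → r w (σ w) := by
  -- `R m v`: some walk of exactly `m` arcs leads from `s` to `v`. Below, minimality of `m` ensures
  -- that the permutation built for the predecessor fixes `v`.
  let R : ℕ → α → Prop := fun m => Nat.rec (· = s) (fun _ P v => ∃ u, P u ∧ r u v) m
  have key : ∀ m v, R m v → (∀ m' < m, ¬ R m' v) → ∃ σ : Equiv.Perm α, σ v = s ∧
      (∀ w, σ w ≠ w → ∃ m' ≤ m, R m' w) ∧ ∀ w, w ≠ v → σ w ≠ w → r w (σ w) := by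
    intro m
    induction m with
    | zero =>
      rintro v (rfl : v = s) -
      exact ⟨1, rfl, fun w hw => absurd rfl hw, fun w _ hw => absurd rfl hw⟩
    | succ m ih =>
      rintro v ⟨u, hu, huv⟩ hmin
      obtain ⟨σ, hσu, hσR, hσr⟩ := ih u hu fun m' hm' hR =>
        hmin (m' + 1) (Nat.succ_lt_succ hm') ⟨u, hR, huv⟩
      have hvs : v ≠ s := fun e => hmin 0 (Nat.succ_pos m) e
      have hσv : σ v = v := by
        by_contra hne
        obtain ⟨m', hm', hR⟩ := hσR v hne
        exact hmin m' (Nat.lt_succ_of_le hm') hR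
      have huv' : u ≠ v := by
        rintro rfl
        exact hmin m (Nat.lt_succ_self m) hu
      have hoff : ∀ w, w ≠ u → w ≠ v → (Equiv.swap s v * σ) w = σ w := by
        intro w h1 h2
        refine Equiv.swap_apply_of_ne_of_ne ?_ ?_
        · rw [← hσu]
          exact fun e => h1 (σ.injective e)
        · intro e
          exact h2 (σ.injective (e.trans hσv.symm))
      -- The closing arc `u → s` is replaced by `u → v → s`.
      refine ⟨Equiv.swap s v * σ, ?_, ?_, ?_⟩
      · rw [Equiv.Perm.mul_apply, hσv, Equiv.swap_apply_right]
      · intro w hw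
        by_cases h1 : w = u
        · subst h1
          exact ⟨m, Nat.le_succ m, hu⟩
        by_cases h2 : w = v
        · subst h2
          exact ⟨m + 1, le_rfl, u, hu, huv⟩
        · rw [hoff w h1 h2] at hw
          obtain ⟨m', hm', hR⟩ := hσR w hw
          exact ⟨m', hm'.trans (Nat.le_succ m), hR⟩
      · intro w h2 hw
        by_cases h1 : w = u
        · subst h1
          rw [Equiv.Perm.mul_apply, hσu, Equiv.swap_apply_left]
          exact huv
        · rw [hoff w h1 h2] at hw ⊢
          exact hσr w h1 hw
  have hex : ∃ m, R m t := by
    induction h with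
    | refl => exact ⟨0, rfl⟩
    | tail _ hbc ih =>
      obtain ⟨m, hm⟩ := ih
      exact ⟨m + 1, _, hm, hbc⟩
  obtain ⟨m, hm, hmin⟩ : ∃ m, R m t ∧ ∀ m' < m, ¬ R m' t := by
    obtain ⟨m, hm, hmin⟩ := WellFounded.has_min Nat.lt_wfRel.wf {m | R m t} hex
    exact ⟨m, hm, fun m' hm' hR => hmin m' hR hm'⟩
  obtain ⟨σ, h1, -, h2⟩ := key m t hm hmin
  exact ⟨σ, h1, h2⟩

/-! ### Walks between clusterings of equal cluster sizes -/

namespace Clustering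

variable {k n : ℕ}

/-- The number of items of cluster `i` of `C` that lie in another cluster of `T`. -/
def misplaced (C T : Clustering k n) (i : Fin k) : ℕ :=
  (Finset.univ.filter fun j => C j = i ∧ T j ≠ i).card

theorem misplaced_le_size (C T : Clustering k n) (i : Fin k) : C.misplaced T i ≤ C.size i :=
  Finset.card_le_card (Finset.monotone_filter_right _ fun _ _ h => h.1)

theorem misplaced_le_misplaced {C C' T : Clustering k n} (h : ∀ j, C' j = C j ∨ C' j = T j)
    (i : Fin k) : C'.misplaced T i ≤ C.misplaced T i := by
  refine Finset.card_le_card (Finset.monotone_filter_right _ fun j _ hj => ?_)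
  rcases h j with e | e
  · exact e ▸ hj
  · exact absurd (e ▸ hj.1) hj.2

theorem misplaced_lt_misplaced {C C' T : Clustering k n} (h : ∀ j, C' j = C j ∨ C' j = T j)
    {j₀ : Fin n} (h₁ : T j₀ ≠ C j₀) (h₂ : C' j₀ = T j₀) :
    C'.misplaced T (C j₀) < C.misplaced T (C j₀) := by
  refine Finset.card_lt_card (Finset.ssubset_iff_of_subset ?_ |>.2 ⟨j₀, ?_, ?_⟩)
  · refine Finset.monotone_filter_right _ fun j _ hj => ?_
    rcases h j with e | e
    · exact e ▸ hj
    · exact absurd (e ▸ hj.1) hj.2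
  · simp [h₁]
  · simp [h₂]

theorem eq_of_misplaced_eq_zero {C T : Clustering k n} (h : ∀ i, C.misplaced T i = 0) : C = T := by
  funext j
  by_contra hne
  have := Finset.filter_eq_empty_iff.1 (Finset.card_eq_zero.1 (h (C j))) (Finset.mem_univ j)
  exact this ⟨rfl, fun e => hne e.symm⟩

/-- Representatives for the arcs `w → σ w`, `w ∈ W`, of the difference graph of `C` and `T`. -/
theorem exists_items {C T : Clustering k n} (σ : Equiv.Perm (Fin k)) (W : Finset (Fin k))
    (h : ∀ w ∈ W, ∃ j, C j = w ∧ T j = σ w) :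
    ∃ J : Finset (Fin n), Set.InjOn C J ∧ J.image C = W ∧ ∀ j ∈ J, T j = σ (C j) := by
  choose f hf using h
  refine ⟨W.attach.image fun w => f w.1 w.2, ?_, ?_, ?_⟩
  · intro j hj j' hj' e
    obtain ⟨w, -, rfl⟩ := Finset.mem_image.1 hj
    obtain ⟨w', -, rfl⟩ := Finset.mem_image.1 hj'
    rw [(hf _ _).1, (hf _ _).1] at e
    rw [Subtype.ext e]
  · ext i
    simp only [Finset.mem_image, Finset.mem_attach, true_and, Subtype.exists]
    constructor
    · rintro ⟨_, ⟨w, hw, rfl⟩, rfl⟩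
      rwa [(hf _ _).1]
    · exact fun hi => ⟨_, ⟨i, hi, rfl⟩, (hf i hi).1⟩
  · intro j hj
    obtain ⟨w, -, rfl⟩ := Finset.mem_image.1 hj
    rw [(hf _ _).1, (hf _ _).2]

theorem move_eq_or_eq {C T : Clustering k n} {J : Finset (Fin n)} {σ : Equiv.Perm (Fin k)}
    (h : ∀ j ∈ J, T j = σ (C j)) (j : Fin n) : C.move J σ j = C j ∨ C.move J σ j = T j := by
  by_cases hj : j ∈ J
  · exact Or.inr (by rw [move_of_mem hj, h j hj])
  · exact Or.inl (move_of_notMem hj)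

/-- The clusters met by `J` include all those moved by `σ`, so `σ` permutes them: each loses one
item and receives one. -/
theorem size_move_of_cover (C : Clustering k n) {J : Finset (Fin n)} (hJ : Set.InjOn C J)
    {σ : Equiv.Perm (Fin k)} (hcov : ∀ i, σ i ≠ i → ∃ j ∈ J, C j = i) (i : Fin k) :
    (C.move J σ).size i = C.size i := by
  have h := C.size_move hJ σ i
  have hiff : i ∈ J.image C ↔ σ⁻¹ i ∈ J.image C := by
    by_cases hi : σ i = i
    · rw [Equiv.Perm.inv_eq_iff_eq.2 hi.symm]
    · have h1 : σ (σ⁻¹ i) ≠ σ⁻¹ i := by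
        intro e
        rw [Equiv.Perm.inv_def, Equiv.apply_symm_apply, Equiv.eq_symm_apply] at e
        exact hi e
      exact iff_of_true (Finset.mem_image.2 (hcov i hi)) (Finset.mem_image.2 (hcov _ h1))
  rw [if_congr hiff rfl rfl] at h
  exact Nat.add_right_cancel h

theorem Feasible.move_of_cover {κp κm : Fin k → ℕ} {C : Clustering k n} (hC : C.Feasible κp κm)
    {J : Finset (Fin n)} (hJ : Set.InjOn C J) {σ : Equiv.Perm (Fin k)}
    (hcov : ∀ i, σ i ≠ i → ∃ j ∈ J, C j = i) : (C.move J σ).Feasible κp κm := fun i => by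
  rw [size_move_of_cover C hJ hcov]
  exact hC i

theorem circuitDist_le_of_move_isCycle {κp κm : Fin k → ℕ} {C : Clustering k n}
    (hC : C.Feasible κp κm) {J : Finset (Fin n)} (hJ : Set.InjOn C J) {τ : Equiv.Perm (Fin k)}
    (hτ : τ.IsCycle) (hcov : ∀ i, τ i ≠ i → ∃ j ∈ J, C j = i) {z : Fin k × Fin n → ℝ} {m : ℕ}
    (h : (BPP n κp κm).circuitDist (C.move J τ).toPoint z ≤ m) :
    (BPP n κp κm).circuitDist C.toPoint z ≤ (m + 1 : ℕ) := by
  refine LinSystem.circuitDist_le_succ _ (toPoint_mem_iff.2 hC) ?_ h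
  obtain ⟨l, hl, -⟩ := id hτ
  -- Items of `J` in clusters fixed by `τ` do not move. Allowing them lets one `J` serve both
  -- factors of a permutation.
  have hmove : C.move J τ = C.move (J.filter fun j => τ (C j) ≠ C j) τ := by
    funext j
    unfold move
    by_cases h1 : j ∈ J <;> by_cases h2 : τ (C j) = C j <;> simp [h1, h2]
  rw [hmove]
  refine isCircuitStep_move κp κm C hτ (hJ.mono ?_) ?_ hl ?_
  · exact Finset.coe_subset.2 (Finset.filter_subset _ _)
  · exact fun j hj => (Finset.mem_filter.1 hj).2
  · rintro i hi -
    obtain ⟨j, hj, rfl⟩ := hcov i hi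
    exact ⟨j, Finset.mem_filter.2 ⟨hj, hi⟩, rfl⟩

theorem move_one (C : Clustering k n) (J : Finset (Fin n)) : C.move J 1 = C := by
  funext j
  simp [move]

theorem circuitDist_le_of_move_cyclicAt {κp κm : Fin k → ℕ} {C : Clustering k n}
    (hC : C.Feasible κp κm) {J : Finset (Fin n)} (hJ : Set.InjOn C J) {τ : Equiv.Perm (Fin k)}
    {x : Fin k} (hτ : τ.CyclicAt x) (hcov : ∀ i, τ i ≠ i → ∃ j ∈ J, C j = i)
    {z : Fin k × Fin n → ℝ} {m : ℕ}
    (h : (BPP n κp κm).circuitDist (C.move J τ).toPoint z ≤ m) :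
    (BPP n κp κm).circuitDist C.toPoint z ≤ (m + 1 : ℕ) := by
  rcases hτ.isCycle_or_eq_one with h1 | rfl
  · exact circuitDist_le_of_move_isCycle hC hJ h1 hcov h
  · rw [move_one] at h
    exact h.trans (by exact_mod_cast Nat.le_succ m)

/-- Moving items along vertex-disjoint cycles takes at most two circuit steps. -/
theorem circuitDist_le_of_move {κp κm : Fin k → ℕ} {C : Clustering k n}
    (hC : C.Feasible κp κm) {J : Finset (Fin n)} (hJ : Set.InjOn C J) {σ : Equiv.Perm (Fin k)}
    (hcov : ∀ i, σ i ≠ i → ∃ j ∈ J, C j = i) {z : Fin k × Fin n → ℝ} {m : ℕ}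
    (h : (BPP n κp κm).circuitDist (C.move J σ).toPoint z ≤ m) :
    (BPP n κp κm).circuitDist C.toPoint z ≤ (m + 2 : ℕ) := by
  by_cases h1 : σ = 1
  · rw [h1, move_one] at h
    exact h.trans (by exact_mod_cast Nat.le_add_right m 2)
  obtain ⟨τ₁, τ₂, x, rfl, hc₁, hc₂, -, hs₁, hs₂⟩ := σ.exists_cyclicAt_mul_cyclicAt h1
  have hcov₁ : ∀ i, τ₁ i ≠ i → ∃ j ∈ J, C j = i := fun i hi => hcov i (mt (hs₁ i) hi)
  refine circuitDist_le_of_move_cyclicAt hC hJ hc₁ hcov₁ (m := m + 1) ?_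
  have hval : ∀ j ∈ J, C.move J τ₁ j = τ₁ (C j) := fun j hj => move_of_mem hj
  refine circuitDist_le_of_move_cyclicAt (hC.move_of_cover hJ hcov₁) (J := J) ?_ hc₂ ?_ ?_
  · intro j hj j' hj' e
    rw [hval j hj, hval j' hj'] at e
    exact hJ hj hj' (τ₁.injective e)
  · intro i hi
    -- After the first step, cluster `i` holds the item of `J` that started in `τ₁⁻¹ i`. If the
    -- product fixed that cluster, so would `τ₁`, and `τ₂` would fix `i`.
    have h2 : (τ₂ * τ₁) (τ₁⁻¹ i) ≠ τ₁⁻¹ i := by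
      intro e
      have e1 := hs₁ _ e
      rw [Equiv.Perm.inv_def, Equiv.apply_symm_apply] at e1
      rw [Equiv.Perm.inv_def, ← e1] at e
      exact hi (hs₂ i e)
    obtain ⟨j, hj, hCj⟩ := hcov _ h2
    exact ⟨j, hj, by rw [hval j hj, hCj, Equiv.Perm.inv_def, Equiv.apply_symm_apply]⟩
  · have : (C.move J τ₁).move J τ₂ = C.move J (τ₂ * τ₁) := by
      funext j
      by_cases hj : j ∈ J
      · rw [move_of_mem hj, move_of_mem hj, move_of_mem hj, Equiv.Perm.mul_apply]
      · rw [move_of_notMem hj, move_of_notMem hj, move_of_notMem hj]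
    rwa [this]

/-- If clusterings with equal cluster sizes have at most `d` misplaced items in each cluster, then
vertex-disjoint cycles of the difference graph cover all clusters with `d` misplaced items. -/
theorem exists_perm_cover {C T : Clustering k n} (hsize : ∀ i, C.size i = T.size i) {d : ℕ}
    (hd : 0 < d) (hmis : ∀ i, C.misplaced T i ≤ d) :
    ∃ σ : Equiv.Perm (Fin k), (∀ i, σ i ≠ i → ∃ j, C j = i ∧ T j = σ i) ∧
      ∀ i, C.misplaced T i = d → σ i ≠ i := by
  let w : Fin k → Fin k → ℕ := fun i i' => (Finset.univ.filter fun j => C j = i ∧ T j = i').card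
  have hrow : ∀ i, ∑ i', w i i' = C.size i := by
    intro i
    rw [size, Finset.card_eq_sum_card_fiberwise (f := T) (t := Finset.univ) (by simp [Set.MapsTo])]
    simp only [Finset.filter_filter, w]
  have hcol : ∀ i', ∑ i, w i i' = T.size i' := by
    intro i'
    rw [size, Finset.card_eq_sum_card_fiberwise (f := C) (t := Finset.univ) (by simp [Set.MapsTo])]
    simp only [Finset.filter_filter, w, and_comm]
  have hdiag : ∀ i, w i i + C.misplaced T i = C.size i := by
    intro i
    simp only [w, misplaced, size]
    rw [← Finset.filter_filter, ← Finset.filter_filter,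
      Finset.card_filter_add_card_filter_not]
  have hd' : (0 : ℝ) < d := by exact_mod_cast hd
  -- Changing the diagonal of `w` to `d - misplaced` makes all row and column sums equal to `d`. The
  -- diagonal entry vanishes exactly where `d` items are misplaced, so a permutation supported on
  -- positive entries must move those clusters.
  let M : Matrix (Fin k) (Fin k) ℝ := Matrix.of fun i i' =>
    ((w i i' : ℝ) + if i = i' then (d : ℝ) - C.size i else 0) / d
  have hMdiag : ∀ i, M i i = ((d : ℝ) - C.misplaced T i) / d := by
    intro i
    simp only [M, Matrix.of_apply, if_true]
    rw [← hdiag i]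
    push_cast
    ring
  have hMoff : ∀ i i', i ≠ i' → M i i' = (w i i' : ℝ) / d := by
    intro i i' h
    simp [M, h]
  have hM : M ∈ doublyStochastic ℝ (Fin k) := by
    rw [mem_doublyStochastic_iff_sum]
    refine ⟨fun i i' => ?_, fun i => ?_, fun i' => ?_⟩
    · by_cases h : i = i'
      · subst h
        rw [hMdiag]
        have : (C.misplaced T i : ℝ) ≤ d := by exact_mod_cast hmis i
        exact div_nonneg (sub_nonneg.2 this) hd'.le
      · rw [hMoff i i' h]
        positivity
    · simp only [M, Matrix.of_apply]
      rw [← Finset.sum_div, Finset.sum_add_distrib, ← Nat.cast_sum, hrow]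
      simp [hd'.ne']
    · simp only [M, Matrix.of_apply]
      rw [← Finset.sum_div, Finset.sum_add_distrib, ← Nat.cast_sum, hcol, ← hsize]
      simp [hd'.ne']
  obtain ⟨c, hc0, hc1, hcM⟩ := exists_eq_sum_perm_of_mem_doublyStochastic hM
  obtain ⟨σ, hσ⟩ : ∃ σ, 0 < c σ := by
    by_contra! h
    have : ∑ σ, c σ = 0 := Finset.sum_eq_zero fun σ _ => le_antisymm (h σ) (hc0 σ)
    rw [hc1] at this
    exact one_ne_zero this
  have hpos : ∀ i, 0 < M i (σ i) := by
    intro i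
    rw [← hcM, Matrix.sum_apply]
    refine Finset.sum_pos' (fun ρ _ => ?_) ⟨σ, Finset.mem_univ _, ?_⟩
    · rw [Matrix.smul_apply, smul_eq_mul]
      refine mul_nonneg (hc0 ρ) ?_
      rw [Equiv.Perm.permMatrix, PEquiv.toMatrix_apply]
      split_ifs <;> norm_num
    · simpa [Equiv.Perm.permMatrix, PEquiv.toMatrix_apply] using hσ
  refine ⟨σ, fun i hi => ?_, fun i hi e => ?_⟩
  · have h := hpos i
    rw [hMoff i _ hi.symm] at h
    have hw : 0 < w i (σ i) := by
      rw [Nat.pos_iff_ne_zero]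
      intro e
      simp [e] at h
    obtain ⟨j, hj⟩ := Finset.card_pos.1 hw
    exact ⟨j, (Finset.mem_filter.1 hj).2⟩
  · have h := hpos i
    rw [e, hMdiag, hi, sub_self, zero_div] at h
    exact lt_irrefl _ h

/-- Disjoint cycles through all clusters of maximal misplacement lower the maximum by one at the
price of two steps. -/
theorem circuitDist_le_two_mul {κp κm : Fin k → ℕ} {T : Clustering k n} (b : ℕ) :
    ∀ C : Clustering k n, C.Feasible κp κm → (∀ i, C.size i = T.size i) →
      (∀ i, C.misplaced T i ≤ b) →
      (BPP n κp κm).circuitDist C.toPoint T.toPoint ≤ (2 * b : ℕ) := by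
  induction b with
  | zero =>
    intro C hC _ hmis
    obtain rfl := eq_of_misplaced_eq_zero fun i => Nat.le_zero.1 (hmis i)
    rw [LinSystem.circuitDist_self _ (toPoint_mem_iff.2 hC)]
    exact zero_le
  | succ b ih =>
    intro C hC hsize hmis
    obtain ⟨σ, hσ, hcover⟩ := exists_perm_cover hsize (Nat.succ_pos b) hmis
    obtain ⟨J, hJ, hJW, hJT⟩ := exists_items (C := C) (T := T) σ
      (Finset.univ.filter fun i => σ i ≠ i) (fun i hi => hσ i (Finset.mem_filter.1 hi).2)
    have hcov : ∀ i, σ i ≠ i → ∃ j ∈ J, C j = i := fun i hi => by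
      rw [← Finset.mem_image, hJW]
      simpa using hi
    refine circuitDist_le_of_move hC hJ hcov (m := 2 * b) ?_
    refine ih _ (hC.move_of_cover hJ hcov)
      (fun i => (size_move_of_cover C hJ hcov i).trans (hsize i)) fun i => ?_
    rcases (hmis i).lt_or_eq with hlt | heq
    · exact (misplaced_le_misplaced (move_eq_or_eq hJT) i).trans (Nat.lt_succ_iff.1 hlt)
    · obtain ⟨j, hj, rfl⟩ := hcov i (hcover i heq)
      have := misplaced_lt_misplaced (C := C) (move_eq_or_eq hJT) (j₀ := j)
        (by rw [hJT j hj]; exact hcover _ heq) (by rw [move_of_mem hj, hJT j hj])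
      omega

/-- The bound for clusterings with equal cluster sizes. -/
theorem circuitDist_le_add {κp κm : Fin k → ℕ} {T : Clustering k n} (u : Fin k) (b c : ℕ) :
    ∀ C : Clustering k n, C.Feasible κp κm → (∀ i, C.size i = T.size i) →
      (∀ i, i ≠ u → C.misplaced T i ≤ b) → C.misplaced T u ≤ b + c →
      (BPP n κp κm).circuitDist C.toPoint T.toPoint ≤ (2 * b + c : ℕ) := by
  induction c with
  | zero =>
    intro C hC hsize hmis hu
    refine circuitDist_le_two_mul b C hC hsize fun i => ?_
    by_cases h : i = u
    · exact h ▸ hu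
    · exact hmis i h
  | succ c ih =>
    intro C hC hsize hmis hu
    rcases hu.lt_or_eq with hlt | heq
    · exact (ih C hC hsize hmis (by omega)).trans (by exact_mod_cast Nat.le_succ _)
    obtain ⟨σ, hσ, hcover⟩ := exists_perm_cover hsize (d := b + (c + 1)) (by omega) fun i => by
      by_cases h : i = u
      · exact h ▸ hu
      · exact (hmis i h).trans (by omega)
    have hσu := hcover u heq
    -- Only `u` exceeds `b`, so the single cycle through `u`, one step, is enough.
    have hτ : ∀ i, σ.cycleOf u i ≠ i → σ.cycleOf u i = σ i ∧ σ i ≠ i := fun i hi => by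
      rw [Equiv.Perm.cycleOf_apply] at hi ⊢
      split_ifs at hi ⊢
      · exact ⟨rfl, hi⟩
      · exact absurd rfl hi
    obtain ⟨J, hJ, hJW, hJT⟩ := exists_items (C := C) (T := T) (σ.cycleOf u)
      (Finset.univ.filter fun i => σ.cycleOf u i ≠ i) (fun i hi => by
        obtain ⟨h1, h2⟩ := hτ i (Finset.mem_filter.1 hi).2
        rw [h1]
        exact hσ i h2)
    have hcov : ∀ i, σ.cycleOf u i ≠ i → ∃ j ∈ J, C j = i := fun i hi => by
      rw [← Finset.mem_image, hJW]
      simpa using hi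
    refine circuitDist_le_of_move_isCycle hC hJ (Equiv.Perm.isCycle_cycleOf σ hσu) hcov
      (m := 2 * b + c) ?_
    refine ih _ (hC.move_of_cover hJ hcov)
      (fun i => (size_move_of_cover C hJ hcov i).trans (hsize i)) (fun i hi => ?_) ?_
    · exact (misplaced_le_misplaced (move_eq_or_eq hJT) i).trans (hmis i hi)
    · have hcu : σ.cycleOf u u ≠ u := by rwa [Equiv.Perm.cycleOf_apply_self]
      obtain ⟨j, hj, hju⟩ := hcov u hcu
      have := misplaced_lt_misplaced (C := C) (move_eq_or_eq hJT) (j₀ := j)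
        (by rw [hJT j hj, hju]; exact hcu) (by rw [move_of_mem hj, hJT j hj])
      rw [hju] at this
      omega

/-! ### Equalising the cluster sizes -/

theorem sum_size (C : Clustering k n) (R : Finset (Fin k)) :
    ∑ i ∈ R, C.size i = (Finset.univ.filter fun j => C j ∈ R).card := by
  rw [Finset.card_eq_sum_card_fiberwise (f := C) (t := R) (by simp [Set.MapsTo])]
  refine Finset.sum_congr rfl fun i hi => ?_
  rw [size, Finset.filter_filter]
  refine congrArg _ (Finset.filter_congr fun j _ => ?_)
  constructor
  · rintro rfl
    exact ⟨hi, rfl⟩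
  · exact fun h => h.2

theorem sum_size_univ (C : Clustering k n) : ∑ i, C.size i = n := by
  simp [sum_size]

/-- A cluster that has to shrink is joined in the difference graph to one that has to grow. -/
theorem exists_reachable_deficit {C T : Clustering k n} {s : Fin k} (hs : T.size s < C.size s) :
    ∃ t, Relation.ReflTransGen (fun u v => ∃ j, C j = u ∧ T j = v) s t ∧
      C.size t < T.size t := by
  classical
  by_contra! h
  -- No arc leaves the set `R` of reachable clusters, so `T` has at least as many items in it as
  -- `C`.
  set R : Finset (Fin k) := Finset.univ.filter fun t =>
    Relation.ReflTransGen (fun u v => ∃ j, C j = u ∧ T j = v) s t with hR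
  have h1 : ∑ i ∈ R, T.size i < ∑ i ∈ R, C.size i := by
    refine Finset.sum_lt_sum (fun i hi => h i (Finset.mem_filter.1 hi).2) ⟨s, ?_, hs⟩
    simp [hR, Relation.ReflTransGen.refl]
  rw [sum_size, sum_size] at h1
  refine absurd (Finset.card_le_card (Finset.monotone_filter_right _ fun j _ hj => ?_)) h1.not_ge
  simp only [hR, Finset.mem_filter, Finset.mem_univ, true_and] at hj ⊢
  exact hj.tail ⟨j, rfl, rfl⟩

/-- The number of items by which clusters of `C` are larger than those of `T`. -/
def excess (C T : Clustering k n) : ℕ := ∑ i, (C.size i - T.size i)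

/-- One circuit step along a path of the difference graph reduces the excess. -/
theorem exists_step_excess {κp κm : Fin k → ℕ} {C T : Clustering k n} (hC : C.Feasible κp κm)
    (hT : T.Feasible κp κm) {s : Fin k} (hs : T.size s < C.size s) :
    ∃ C' : Clustering k n, C'.Feasible κp κm ∧ (∀ j, C' j = C j ∨ C' j = T j) ∧
      C'.excess T + 1 = C.excess T ∧
      (BPP n κp κm).IsCircuitStep C.toPoint C'.toPoint := by
  obtain ⟨t, hst, ht⟩ := exists_reachable_deficit hs
  have hne : s ≠ t := by
    rintro rfl
    omega
  obtain ⟨σ, hσt, hσ⟩ := exists_perm_of_reflTransGen _ hst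
  set τ := σ.cycleOf t with hτ
  have hτt : τ t = s := by rw [hτ, Equiv.Perm.cycleOf_apply_self, hσt]
  have hcyc : τ.IsCycle := Equiv.Perm.isCycle_cycleOf σ (by rwa [hσt])
  have hτσ : ∀ i, τ i ≠ i → τ i = σ i := fun i hi => by
    rw [hτ, Equiv.Perm.cycleOf_apply] at hi ⊢
    split_ifs at hi ⊢
    · rfl
    · exact absurd rfl hi
  -- The closing arc `t → s` need not belong to the difference graph, so no item of `t` moves.
  obtain ⟨J, hJ, hJW, hJT⟩ := exists_items (C := C) (T := T) τ
    (Finset.univ.filter fun i => τ i ≠ i ∧ i ≠ t) (fun i hi => by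
      obtain ⟨-, h1, h2⟩ := Finset.mem_filter.1 hi
      have e := hτσ i h1
      rw [e] at h1 ⊢
      exact hσ i h2 h1)
  have hmem : ∀ i, i ∈ J.image C ↔ τ i ≠ i ∧ i ≠ t := fun i => by simp [hJW]
  have hinv : ∀ i, τ⁻¹ i ∈ J.image C ↔ τ i ≠ i ∧ i ≠ s := fun i => by
    rw [hmem]
    refine and_congr (not_congr ?_) (not_congr ?_)
    · rw [Equiv.Perm.inv_def, Equiv.apply_symm_apply, Equiv.eq_symm_apply]
    · rw [Equiv.Perm.inv_eq_iff_eq, hτt]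
  have hsize : ∀ i, (C.move J τ).size i + (if τ i ≠ i ∧ i ≠ t then 1 else 0) =
      C.size i + (if τ i ≠ i ∧ i ≠ s then 1 else 0) := fun i => by
    have h := C.size_move hJ τ i
    rw [if_congr (hmem i) rfl rfl, if_congr (hinv i) rfl rfl] at h
    exact h
  have hτtt : τ t ≠ t := by rwa [hτt]
  have hτs : τ s ≠ s := by
    rw [← hτt]
    exact fun e => hτtt (τ.injective e)
  have hsizet : (C.move J τ).size t = C.size t + 1 := by
    simpa [hτtt, hne.symm] using hsize t
  have hsizes : (C.move J τ).size s + 1 = C.size s := by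
    simpa [hτs, hne] using hsize s
  have hsizeo : ∀ i, i ≠ s → i ≠ t → (C.move J τ).size i = C.size i := fun i h1 h2 => by
    simpa [h1, h2] using hsize i
  refine ⟨C.move J τ, fun i => ?_, move_eq_or_eq hJT, ?_, ?_⟩
  · have hCi := hC i
    have hTi := hT i
    by_cases h1 : i = s
    · subst h1; omega
    · by_cases h2 : i = t
      · subst h2; omega
      · rw [hsizeo i h1 h2]; exact hCi
  · unfold excess
    rw [← Finset.add_sum_erase _ _ (Finset.mem_univ s),
      ← Finset.add_sum_erase _ _ (Finset.mem_univ s)]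
    have : ∑ i ∈ Finset.univ.erase s, ((C.move J τ).size i - T.size i) =
        ∑ i ∈ Finset.univ.erase s, (C.size i - T.size i) := by
      refine Finset.sum_congr rfl fun i hi => ?_
      have h1 := Finset.ne_of_mem_erase hi
      by_cases h2 : i = t
      -- Cluster `t` is still no larger than in `T`, so its truncated difference remains zero.
      · subst h2; omega
      · rw [hsizeo i h1 h2]
    omega
  · refine isCircuitStep_move κp κm C hcyc hJ (fun j hj => ?_) hτtt fun i h1 h2 => ?_
    · exact ((hmem _).1 (Finset.mem_image_of_mem C hj)).1
    · exact Finset.mem_image.1 ((hmem i).2 ⟨h1, h2⟩)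

/-- Excess zero forces equal sizes because both totals are `n`. The last clause charges one step per
unit of excess. -/
theorem exists_equal_size {κp κm : Fin k → ℕ} {T : Clustering k n} (hT : T.Feasible κp κm) (e : ℕ) :
    ∀ C : Clustering k n, C.Feasible κp κm → C.excess T = e →
      ∃ C' : Clustering k n, C'.Feasible κp κm ∧ (∀ j, C' j = C j ∨ C' j = T j) ∧
        (∀ i, C'.size i = T.size i) ∧ ∀ (z : Fin k × Fin n → ℝ) (m : ℕ),
          (BPP n κp κm).circuitDist C'.toPoint z ≤ m →
          (BPP n κp κm).circuitDist C.toPoint z ≤ (m + e : ℕ) := by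
  induction e with
  | zero =>
    intro C hC h0
    refine ⟨C, hC, fun j => Or.inl rfl, fun i => ?_, fun z m h => h⟩
    have hle : ∀ i ∈ Finset.univ, C.size i ≤ T.size i := fun i hi =>
      Nat.sub_eq_zero_iff_le.1 (Finset.sum_eq_zero_iff.1 h0 i hi)
    exact (Finset.sum_eq_sum_iff_of_le hle).1 ((sum_size_univ C).trans (sum_size_univ T).symm) i
      (Finset.mem_univ i)
  | succ e ih =>
    intro C hC he
    obtain ⟨s, hs⟩ : ∃ s, T.size s < C.size s := by
      by_contra! h
      have : C.excess T = 0 := Finset.sum_eq_zero fun i _ => Nat.sub_eq_zero_of_le (h i)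
      omega
    obtain ⟨C₁, hC₁, hb₁, he₁, hstep⟩ := exists_step_excess hC hT hs
    obtain ⟨C', hC', hb', hsize, hdist⟩ := ih C₁ hC₁ (by omega)
    refine ⟨C', hC', fun j => ?_, hsize, fun z m h => ?_⟩
    · rcases hb' j with h | h
      · rw [h]; exact hb₁ j
      · exact Or.inr h
    · exact LinSystem.circuitDist_le_succ _ (toPoint_mem_iff.2 hC) hstep (hdist z m h)

/-! ### Integrality of the vertices -/

/-- The additive group of integers inside `ℝ`. -/
abbrev intSubgroup : AddSubgroup ℝ := (Int.castAddHom ℝ).range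

theorem natCast_mem_intSubgroup (m : ℕ) : (m : ℝ) ∈ intSubgroup := ⟨m, by simp⟩

theorem eq_zero_or_one_of_mem_intSubgroup {x : ℝ} (hx : x ∈ intSubgroup) (h0 : 0 ≤ x)
    (h1 : x ≤ 1) : x = 0 ∨ x = 1 := by
  obtain ⟨m, rfl⟩ := hx
  simp only [Int.coe_castAddHom] at h0 h1 ⊢
  have h0' : 0 ≤ m := by exact_mod_cast h0
  have h1' : m ≤ 1 := by exact_mod_cast h1
  have : m = 0 ∨ m = 1 := by omega
  exact_mod_cast this

/-- If a sum is an integer and one summand is not, then at least two summands are not. -/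
theorem two_le_card_of_sum_mem {ι : Type*} [Fintype ι] [DecidableEq ι] (f : ι → ℝ)
    (p : ι → Prop) [DecidablePred p] (hp : ∀ i, p i ↔ f i ∉ intSubgroup)
    (hsum : ∑ i, f i ∈ intSubgroup) {i₀ : ι} (hi₀ : p i₀) :
    2 ≤ (Finset.univ.filter p).card := by
  by_contra! hlt
  have hle : (Finset.univ.filter p).card ≤ 1 := by omega
  refine (hp i₀).1 hi₀ ?_
  rw [← Finset.add_sum_erase _ _ (Finset.mem_univ i₀)] at hsum
  refine (AddSubgroup.add_mem_cancel_right _ (AddSubgroup.sum_mem _ fun i hi => ?_)).1 hsum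
  by_contra hne
  refine Finset.ne_of_mem_erase hi (Finset.card_le_one.1 hle i ?_ i₀ ?_)
  · simpa using (hp i).2 hne
  · simpa using hi₀

/-- A fractional point admits a perturbation that preserves all column sums, all integral row sums
and all integral entries. -/
theorem exists_perturbation {y : Fin k × Fin n → ℝ} (hcol : ∀ j, ∑ i, y (i, j) = 1)
    {v₀ : Fin k × Fin n} (hv₀ : y v₀ ∉ intSubgroup) :
    ∃ z : Fin k × Fin n → ℝ, z ≠ 0 ∧ (∀ v, y v ∈ intSubgroup → z v = 0) ∧
      (∀ j, ∑ i, z (i, j) = 0) ∧ ∀ i, ∑ j, y (i, j) ∈ intSubgroup → ∑ j, z (i, j) = 0 := by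
  classical
  let p : Fin k × Fin n → Prop := fun v => y v ∉ intSubgroup
  -- The constraint of row `i₀` can be dropped: either its sum is fractional and imposes nothing, or
  -- all row sums are integral and its constraint follows from the other rows and the columns.
  obtain ⟨i₀, hi₀, j₀, hij₀⟩ : ∃ i₀, ((∑ j, y (i₀, j) ∉ intSubgroup) ∨
      ∀ i, ∑ j, y (i, j) ∈ intSubgroup) ∧ ∃ j, p (i₀, j) := by
    by_cases h : ∃ i, ∑ j, y (i, j) ∉ intSubgroup
    · obtain ⟨i, hi⟩ := h
      refine ⟨i, Or.inl hi, ?_⟩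
      by_contra! hall
      exact hi (AddSubgroup.sum_mem _ fun j _ => not_not.1 (hall j))
    · push Not at h
      exact ⟨v₀.1, Or.inr h, v₀.2, hv₀⟩
  let F := {v // p v}
  let I := {i // i ≠ i₀ ∧ ∑ j, y (i, j) ∈ intSubgroup ∧ ∃ j, p (i, j)}
  let J := {j // ∃ i, p (i, j)}
  -- Each constrained column or row has at least two fractional entries, while row `i₀` has some but
  -- is not counted. Hence there are fewer equations than unknowns.
  have hcard : Fintype.card J + Fintype.card I < Fintype.card F := by
    have h1 : Fintype.card F = ∑ j, (Finset.univ.filter fun i => p (i, j)).card := by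
      rw [Fintype.card_subtype, Finset.card_filter, Fintype.sum_prod_type_right]
      simp only [Finset.card_filter]
    have h2 : Fintype.card F = ∑ i, (Finset.univ.filter fun j => p (i, j)).card := by
      rw [Fintype.card_subtype, Finset.card_filter, Fintype.sum_prod_type]
      simp only [Finset.card_filter]
    have h3 : 2 * Fintype.card J ≤ Fintype.card F := by
      rw [h1, Fintype.card_subtype, Finset.card_filter, Finset.mul_sum]
      refine Finset.sum_le_sum fun j _ => ?_
      split_ifs with h
      · obtain ⟨i, hi⟩ := h
        exact two_le_card_of_sum_mem (fun i => y (i, j)) (fun i => p (i, j)) (fun _ => Iff.rfl)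
          (by rw [hcol]; exact_mod_cast natCast_mem_intSubgroup 1) hi
      · exact Nat.zero_le _
    have h4 : 2 * Fintype.card I < Fintype.card F := by
      rw [h2, Fintype.card_subtype, Finset.card_filter, Finset.mul_sum]
      refine Finset.sum_lt_sum (fun i _ => ?_) ⟨i₀, Finset.mem_univ _, ?_⟩
      · split_ifs with h
        · obtain ⟨-, h, j, hj⟩ := h
          exact two_le_card_of_sum_mem (fun j => y (i, j)) (fun j => p (i, j)) (fun _ => Iff.rfl)
            h hj
        · exact Nat.zero_le _
      · rw [if_neg fun h => h.1 rfl]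
        exact Finset.card_pos.2 ⟨j₀, by simpa using hij₀⟩
    omega
  let ext : (F → ℝ) →ₗ[ℝ] (Fin k × Fin n → ℝ) :=
    { toFun := fun x v => if h : p v then x ⟨v, h⟩ else 0
      map_add' := fun x x' => by
        funext v
        by_cases h : p v <;> simp [h]
      map_smul' := fun a x => by
        funext v
        by_cases h : p v <;> simp [h] }
  have hext : ∀ x v, ¬ p v → ext x v = 0 := fun x v h => dif_neg h
  let L : (F → ℝ) →ₗ[ℝ] (J ⊕ I → ℝ) := LinearMap.pi fun c => Sum.elim
    (fun j : J => ∑ i, LinearMap.proj (i, j.1) ∘ₗ ext)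
    (fun i : I => ∑ j, LinearMap.proj (i.1, j) ∘ₗ ext) c
  have hker : LinearMap.ker L ≠ ⊥ := by
    refine LinearMap.ker_ne_bot_of_finrank_lt ?_
    rw [Module.finrank_fintype_fun_eq_card, Module.finrank_fintype_fun_eq_card, Fintype.card_sum]
    exact hcard
  obtain ⟨x, hxL, hx0⟩ := (Submodule.ne_bot_iff _).1 hker
  rw [LinearMap.mem_ker] at hxL
  have hzcol : ∀ j, ∑ i, ext x (i, j) = 0 := by
    intro j
    by_cases h : ∃ i, p (i, j)
    · have := congrFun hxL (Sum.inl ⟨j, h⟩)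
      simpa [L] using this
    · push Not at h
      exact Finset.sum_eq_zero fun i _ => hext x _ (h i)
  have hzrow : ∀ i, i ≠ i₀ → ∑ j, y (i, j) ∈ intSubgroup → ∑ j, ext x (i, j) = 0 := by
    intro i hi hH
    by_cases h : ∃ j, p (i, j)
    · have := congrFun hxL (Sum.inr ⟨i, hi, hH, h⟩)
      simpa [L] using this
    · push Not at h
      exact Finset.sum_eq_zero fun j _ => hext x _ (h j)
  refine ⟨ext x, fun h => hx0 ?_, fun v hv => hext x v (not_not.2 hv), hzcol, fun i hi => ?_⟩
  · funext v
    have := congrFun h v.1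
    simpa [ext, v.2] using this
  · by_cases hii : i = i₀
    · subst hii
      have hall := hi₀.resolve_left (not_not.2 hi)
      have htot : ∑ i, ∑ j, ext x (i, j) = 0 := by
        rw [Finset.sum_comm]
        exact Finset.sum_eq_zero fun j _ => hzcol j
      rw [← Finset.add_sum_erase _ _ (Finset.mem_univ i),
        Finset.sum_eq_zero (s := Finset.univ.erase i), add_zero] at htot
      · exact htot
      · exact fun i' hi' => hzrow i' (Finset.ne_of_mem_erase hi') (hall i')
    · exact hzrow i hii hi

theorem eventually_lt_add_mul {a b : ℝ} (h : a < b) (c : ℝ) :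
    ∀ᶠ ε in nhdsWithin (0 : ℝ) (Set.Ioi 0), a < b + ε * c := by
  have : Filter.Tendsto (fun ε : ℝ => b + ε * c) (nhds 0) (nhds (b + 0 * c)) :=
    Continuous.tendsto (by fun_prop) 0
  rw [zero_mul, add_zero] at this
  exact (this.eventually (lt_mem_nhds h)).filter_mono nhdsWithin_le_nhds

/-- Small perturbations as in `exists_perturbation` stay in the polytope. -/
theorem eventually_add_smul_mem {κp κm : Fin k → ℕ} {y z : Fin k × Fin n → ℝ}
    (hy : y ∈ (BPP n κp κm).polyhedron) (hz : ∀ v, y v ∈ intSubgroup → z v = 0)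
    (hcol : ∀ j, ∑ i, z (i, j) = 0)
    (hrow : ∀ i, ∑ j, y (i, j) ∈ intSubgroup → ∑ j, z (i, j) = 0) :
    ∀ᶠ ε in nhdsWithin (0 : ℝ) (Set.Ioi 0), y + ε • z ∈ (BPP n κp κm).polyhedron := by
  rw [mem_BPP_polyhedron] at hy
  obtain ⟨h1, h2, h3, h4⟩ := hy
  have e2 : ∀ᶠ ε in nhdsWithin (0 : ℝ) (Set.Ioi 0), ∀ i,
      (κm i : ℝ) ≤ ∑ j, y (i, j) + ε * ∑ j, z (i, j) := by
    refine Filter.eventually_all.2 fun i => ?_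
    by_cases hi : ∑ j, y (i, j) ∈ intSubgroup
    · simp [hrow i hi, h2 i]
    -- A fractional sum cannot equal an integral bound, so there is slack.
    · refine (eventually_lt_add_mul ((h2 i).lt_of_ne ?_) _).mono fun _ h => h.le
      exact fun e => hi (e ▸ natCast_mem_intSubgroup _)
  have e3 : ∀ᶠ ε in nhdsWithin (0 : ℝ) (Set.Ioi 0), ∀ i,
      ∑ j, y (i, j) + ε * ∑ j, z (i, j) ≤ (κp i : ℝ) := by
    refine Filter.eventually_all.2 fun i => ?_
    by_cases hi : ∑ j, y (i, j) ∈ intSubgroup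
    · simp [hrow i hi, h3 i]
    · refine (eventually_lt_add_mul (neg_lt_neg ((h3 i).lt_of_ne ?_)) (-∑ j, z (i, j))).mono
        fun _ h => by linarith
      exact fun e => hi (e ▸ natCast_mem_intSubgroup _)
  have e4 : ∀ᶠ ε in nhdsWithin (0 : ℝ) (Set.Ioi 0), ∀ v, 0 ≤ y v + ε * z v := by
    refine Filter.eventually_all.2 fun v => ?_
    by_cases hv : y v ∈ intSubgroup
    · simpa [hz v hv] using h4 v.1 v.2
    · refine (eventually_lt_add_mul ((h4 v.1 v.2).lt_of_ne ?_) _).mono fun _ h => h.le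
      exact fun e => hv (e ▸ AddSubgroup.zero_mem _)
  filter_upwards [e2, e3, e4] with ε e2 e3 e4
  rw [mem_BPP_polyhedron]
  simp only [Pi.add_apply, Pi.smul_apply, smul_eq_mul, Finset.sum_add_distrib, ← Finset.mul_sum,
    h1, hcol, mul_zero, add_zero, implies_true, true_and]
  exact ⟨e2, e3, fun i j => e4 (i, j)⟩

/-- The vertices of the bounded-size partition polytope are incidence vectors of clusterings. -/
theorem exists_toPoint_of_mem_extremePoints {κp κm : Fin k → ℕ} {y : Fin k × Fin n → ℝ}
    (hy : y ∈ Set.extremePoints ℝ (BPP n κp κm).polyhedron) :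
    ∃ C : Clustering k n, C.Feasible κp κm ∧ y = C.toPoint := by
  obtain ⟨hyP, hext⟩ := hy
  obtain ⟨h1, h2, h3, h4⟩ := (mem_BPP_polyhedron _ _ _).1 hyP
  have hint : ∀ v, y v ∈ intSubgroup := by
    by_contra! hne
    obtain ⟨v₀, hv₀⟩ := hne
    obtain ⟨z, hz0, hz, hcol, hrow⟩ := exists_perturbation h1 hv₀
    have hm := eventually_add_smul_mem hyP (z := -z) (fun v hv => by simp [hz v hv])
      (fun j => by simp [hcol j]) (fun i hi => by simp [hrow i hi])
    obtain ⟨ε, ⟨hp, hm⟩, hε⟩ :=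
      (((eventually_add_smul_mem hyP hz hcol hrow).and hm).and self_mem_nhdsWithin).exists
    have hε' : ε ≠ 0 := ne_of_gt hε
    -- `y` is the midpoint of `y + ε • z` and `y - ε • z`.
    have := hext hp hm ⟨1 / 2, 1 / 2, by norm_num, by norm_num, by norm_num, by module⟩
    rw [add_eq_left, smul_eq_zero] at this
    exact this.elim hε' hz0
  have h01 : ∀ v, y v = 0 ∨ y v = 1 := fun v => by
    refine eq_zero_or_one_of_mem_intSubgroup (hint v) (h4 v.1 v.2) ?_
    rw [← h1 v.2]
    exact Finset.single_le_sum (f := fun i => y (i, v.2)) (fun i _ => h4 i v.2)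
      (Finset.mem_univ v.1)
  have hone : ∀ j, ∃ i, y (i, j) = 1 := by
    intro j
    by_contra! h
    have : ∑ i, y (i, j) = 0 := Finset.sum_eq_zero fun i _ => (h01 _).resolve_right (h i)
    rw [h1] at this
    exact one_ne_zero this
  choose C hC using hone
  have hyC : y = toPoint C := by
    funext ⟨i, j⟩
    by_cases h : C j = i
    · subst h
      simp [toPoint, hC]
    · have hle := Finset.add_le_sum (f := fun i => y (i, j)) (fun i _ => h4 i j)
        (Finset.mem_univ (C j)) (Finset.mem_univ i) h
      rw [h1] at hle
      have := hC j
      have := h4 i j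
      simp only [toPoint, h, if_false]
      linarith
  exact ⟨C, toPoint_mem_iff.1 (hyC ▸ hyP), hyC⟩

/-! ### Counting the steps -/

/-- The size differences sum to zero, and `|x|` is twice the positive part of `x` minus `x`. -/
theorem two_mul_excess (C T : Clustering k n) :
    2 * (C.excess T : ℤ) = ∑ i, |(C.size i : ℤ) - T.size i| := by
  have h1 : ∑ i, ((C.size i : ℤ) - T.size i) = 0 := by
    rw [Finset.sum_sub_distrib, ← Nat.cast_sum, ← Nat.cast_sum, sum_size_univ, sum_size_univ,
      sub_self]
  have h2 : (2 * (C.excess T : ℤ)) =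
      ∑ i, (2 * ((C.size i - T.size i : ℕ) : ℤ) - ((C.size i : ℤ) - T.size i)) := by
    rw [Finset.sum_sub_distrib, h1, sub_zero, excess, Nat.cast_sum, Finset.mul_sum]
  rw [h2]
  refine Finset.sum_congr rfl fun i _ => ?_
  rcases le_total (C.size i) (T.size i) with h | h
  · rw [Nat.sub_eq_zero_of_le h, abs_of_nonpos (by omega)]
    push_cast
    ring
  · rw [abs_of_nonneg (by omega), Nat.cast_sub h]
    ring

/-- The distance bound with the two clusters `u ≠ v` that determine the length of the walk. -/
theorem exists_circuitDist_le {κp κm : Fin k → ℕ} (hk : 2 ≤ k) {C T : Clustering k n}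
    (hC : C.Feasible κp κm) (hT : T.Feasible κp κm) :
    ∃ (u v : Fin k) (m : ℕ), u ≠ v ∧ (BPP n κp κm).circuitDist C.toPoint T.toPoint ≤ m ∧
      2 * (m : ℤ) ≤ 2 * (κp u + κp v) + ∑ i ∈ (Finset.univ.erase u).erase v,
        ((κp i : ℤ) - κm i) := by
  obtain ⟨C', hC', hb, hsize, hdist⟩ := exists_equal_size hT _ C hC rfl
  set r : Fin k → ℕ := C'.misplaced T with hr
  have hrC : ∀ i, r i ≤ C.size i := fun i =>
    (misplaced_le_misplaced hb i).trans (misplaced_le_size C T i)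
  have hrT : ∀ i, r i ≤ T.size i := fun i => hsize i ▸ misplaced_le_size C' T i
  -- The smaller size plus the difference is the larger size.
  have hrκ : ∀ i, (r i : ℤ) + |(C.size i : ℤ) - T.size i| ≤ κp i := by
    intro i
    have := hrC i
    have := hrT i
    have := (hC i).2
    have := (hT i).2
    rcases abs_cases ((C.size i : ℤ) - T.size i) with h | h <;> omega
  have habs : ∀ i, |(C.size i : ℤ) - T.size i| ≤ (κp i : ℤ) - κm i := by
    intro i
    have := hC i
    have := hT i
    rw [abs_le]
    omega
  obtain ⟨u, -, hu⟩ := Finset.exists_max_image Finset.univ r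
    ⟨⟨0, two_pos.trans_le hk⟩, Finset.mem_univ _⟩
  have hnon : (Finset.univ.erase u).Nonempty := by
    rw [← Finset.card_pos, Finset.card_erase_of_mem (Finset.mem_univ u), Finset.card_fin]
    omega
  obtain ⟨v, hv, hvmax⟩ := Finset.exists_max_image _ r hnon
  have hvu := Finset.ne_of_mem_erase hv
  have hle : r v ≤ r u := hu v (Finset.mem_univ v)
  have hwalk := circuitDist_le_add u (r v) (r u - r v) C' hC' hsize
    (fun i hi => hvmax i (Finset.mem_erase.2 ⟨hi, Finset.mem_univ i⟩))
    (by change r u ≤ _; omega)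
  refine ⟨u, v, _, hvu.symm, hdist _ _ hwalk, ?_⟩
  have hex := two_mul_excess C T
  rw [← Finset.add_sum_erase _ _ (Finset.mem_univ u), ← Finset.add_sum_erase _ _ hv] at hex
  have hsum := Finset.sum_le_sum (s := (Finset.univ.erase u).erase v) fun i _ => habs i
  have hu' := hrκ u
  have hv' := hrκ v
  have := abs_nonneg ((C.size u : ℤ) - T.size u)
  have := abs_nonneg ((C.size v : ℤ) - T.size v)
  have hcast : ((2 * r v + (r u - r v) + C.excess T : ℕ) : ℤ) = r u + r v + C.excess T := by
    push_cast [Nat.cast_sub hle]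
    ring
  rw [hcast]
  linarith

theorem add_le_add_of_antitone {κ : Fin k → ℕ} (h₀ : 0 < k) (h₁ : 1 < k) (hκ : Antitone κ)
    {u v : Fin k} (huv : u ≠ v) : κ u + κ v ≤ κ ⟨0, h₀⟩ + κ ⟨1, h₁⟩ := by
  wlog h : u < v generalizing u v
  · rw [add_comm (κ u)]
    exact this huv.symm (huv.lt_or_gt.resolve_left h)
  refine Nat.add_le_add (hκ (Fin.mk_le_of_le_val (Nat.zero_le _))) (hκ (Fin.mk_le_of_le_val ?_))
  have : u.1 < v.1 := h
  omega

/-- Leaving out the two smallest summands gives the largest sum. -/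
theorem sum_erase_erase_le {κ : Fin k → ℤ} {i₁ i₂ u v : Fin k} (hne : i₁ ≠ i₂)
    (hmin : ∀ i, i ≠ i₁ → i ≠ i₂ → κ i₁ ≤ κ i ∧ κ i₂ ≤ κ i) (huv : u ≠ v) :
    ∑ i ∈ (Finset.univ.erase u).erase v, κ i ≤
      ∑ i ∈ Finset.univ.filter (fun i => i ≠ i₁ ∧ i ≠ i₂), κ i := by
  have hfilter : Finset.univ.filter (fun i => i ≠ i₁ ∧ i ≠ i₂) =
      (Finset.univ.erase i₁).erase i₂ := by
    ext i
    simp [and_comm]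
  have hsum : ∀ a b : Fin k, a ≠ b →
      κ a + (κ b + ∑ i ∈ (Finset.univ.erase a).erase b, κ i) = ∑ i, κ i := by
    intro a b hab
    rw [Finset.add_sum_erase _ _ (Finset.mem_erase.2 ⟨hab.symm, Finset.mem_univ b⟩),
      Finset.add_sum_erase _ _ (Finset.mem_univ a)]
  have h1 := hsum u v huv
  have h2 := hsum i₁ i₂ hne
  rw [hfilter]
  -- Both sums complete to the same total, so only the omitted pairs need comparing.
  suffices κ i₁ + κ i₂ ≤ κ u + κ v by linarith
  by_cases hu1 : u = i₁
  · subst hu1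
    by_cases hv2 : v = i₂
    · rw [hv2]
    · linarith [(hmin v huv.symm hv2).2]
  · by_cases hu2 : u = i₂
    · subst hu2
      by_cases hv1 : v = i₁
      · rw [hv1, add_comm]
      · linarith [(hmin v hv1 huv.symm).1]
    · by_cases hv1 : v = i₁
      · subst hv1
        linarith [(hmin u hu1 hu2).2]
      · by_cases hv2 : v = i₂
        · subst hv2
          linarith [(hmin u hu1 hu2).1]
        · linarith [(hmin u hu1 hu2).1, (hmin v hv1 hv2).2]

end Clustering

theorem mainTheorem8 {k n : ℕ} (hk : 2 ≤ k) (κp κm : Fin k → ℕ)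
    (hle : ∀ i, κm i ≤ κp i) (hanti : Antitone κp)
    (i₁ i₂ : Fin k) (hne : i₁ ≠ i₂)
    (hmin : ∀ i, i ≠ i₁ → i ≠ i₂ →
      (κp i₁ : ℤ) - κm i₁ ≤ (κp i : ℤ) - κm i ∧ (κp i₂ : ℤ) - κm i₂ ≤ (κp i : ℤ) - κm i) :
    ∃ D : ℕ, (BPP n κp κm).circuitDiameter = (D : ℕ∞) ∧
      (D : ℝ) ≤ (κp ⟨0, by omega⟩ : ℝ) + (κp ⟨1, by omega⟩ : ℝ) +
        1 / 2 * ∑ i ∈ Finset.univ.filter (fun i => i ≠ i₁ ∧ i ≠ i₂), ((κp i : ℝ) - (κm i : ℝ)) := by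
  set B : ℝ := (κp ⟨0, by omega⟩ : ℝ) + (κp ⟨1, by omega⟩ : ℝ) +
    1 / 2 * ∑ i ∈ Finset.univ.filter (fun i => i ≠ i₁ ∧ i ≠ i₂), ((κp i : ℝ) - (κm i : ℝ)) with hB
  have hB0 : 0 ≤ B := by
    have : 0 ≤ ∑ i ∈ Finset.univ.filter (fun i => i ≠ i₁ ∧ i ≠ i₂), ((κp i : ℝ) - (κm i : ℝ)) :=
      Finset.sum_nonneg fun i _ => sub_nonneg.2 (by exact_mod_cast hle i)
    positivity
  -- `B` may be a half-integer; distances are integers, so its floor bounds them and shows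
  -- finiteness.
  have hdiam : (BPP n κp κm).circuitDiameter ≤ (⌊B⌋₊ : ℕ) := by
    refine iSup₂_le fun y hy => iSup₂_le fun y' hy' => ?_
    obtain ⟨C, hC, rfl⟩ := Clustering.exists_toPoint_of_mem_extremePoints hy
    obtain ⟨T, hT, rfl⟩ := Clustering.exists_toPoint_of_mem_extremePoints hy'
    obtain ⟨u, v, m, huv, hdist, hm⟩ := Clustering.exists_circuitDist_le hk hC hT
    refine hdist.trans (Nat.cast_le.2 (Nat.le_floor ?_))
    have h1 := Clustering.add_le_add_of_antitone (by omega) hk hanti huv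
    have h2 := hm.trans (add_le_add le_rfl
      (Clustering.sum_erase_erase_le (κ := fun i => (κp i : ℤ) - κm i) hne hmin huv))
    have h1' : (κp u : ℝ) + κp v ≤ κp ⟨0, by omega⟩ + κp ⟨1, by omega⟩ := by exact_mod_cast h1
    have h2' : 2 * (m : ℝ) ≤ 2 * (κp u + κp v) +
        ∑ i ∈ Finset.univ.filter (fun i => i ≠ i₁ ∧ i ≠ i₂), ((κp i : ℝ) - (κm i : ℝ)) := by
      exact_mod_cast h2
    rw [hB]
    linarith
  obtain ⟨D, hD⟩ := ENat.ne_top_iff_exists.1 (hdiam.trans_lt (ENat.natCast_lt_top _)).ne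
  refine ⟨D, hD.symm, ?_⟩
  rw [← hD, Nat.cast_le] at hdiam
  exact (Nat.cast_le.2 hdiam).trans (Nat.floor_le hB0)
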